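/- Let $\mathbb{A}_{\mathbb Q}$ be the ring of adèles of $\mathbb{Q}$ and $\Sigma_{\mathbb Q}$ the set of all places of $\mathbb Q$ (including the archimedean one). For a nonzero commutative $\mathbb{Q}$-algebra $A$, let $A/\mathbb{Q}^\times$ denote the Krasner hyperring of orbits of $\mathbb{Q}^\times$ acting on $A$ by multiplication, with multiplication $x\mathbb{Q}^\times\cdot y\mathbb{Q}^\times = xy\,\mathbb{Q}^\times$ and multivalued addition $$x\mathbb{Q}^\times + y\mathbb{Q}^\times=\{(rx+sy)\mathbb{Q}^\times : r,s\in\mathbb{Q}^\times\}.$$ Let $\mathbb{H}_{\mathbb Q}=\mathbb{A}_{\mathbb Q}/\mathbb{Q}^\times$ be the hyperring of adèle classes. A homomorphism of hyperrings is a map $f$ with $f(0)=0$, $f(1)=1$, $f(xy)=f(x)f(y)$ and $f(x+y)\subseteq f(x)+f(y)$ for all $x,y$; an ordinary nonzero ring such as $\mathbb{Z}[T]$ is regarded as a hyperring with single-valued addition. For $Z\subseteq\Sigma_{\mathbb Q}$ let $e_Z\in\mathbb{A}_{\mathbb Q}$ be the idempotent whose component is $1$ at the places in $Z$ and $0$ at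 the places not in $Z$, and let $\mathbb{Q}[e_Z]\subseteq\mathbb{A}_{\mathbb Q}$ be the $\mathbb{Q}$-subalgebra it generates. **Theorem.** Let $\rho:\mathbb{Z}[T]\to\mathbb{H}_{\mathbb Q}$ be a homomorphism of hyperrings. Then at least one of the following holds: 1. there is a unique adèle $a\in\mathbb{A}_{\mathbb Q}$ such that $\rho(P)=P(a)\,\mathbb{Q}^\times$ for all $P\in\mathbb{Z}[T]$; 2. there is a subset $Z\subseteq\Sigma_{\mathbb Q}$ such that $\rho$ factors as a homomorphism of hyperrings $\mathbb{Z}[T]\to\mathbb{Q}[e_Z]/\mathbb{Q}^\times$ followed by the homomorphism $\mathbb{Q}[e_Z]/\mathbb{Q}^\times\to\mathbb{H}_{\mathbb Q}$ induced by the inclusion $\mathbb{Q}[e_Z]\subseteq\mathbb{A}_{\mathbb Q}$. -/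

import Mathlib

open Polynomial IsDedekindDomain NumberField

noncomputable section

/-- A (unital) Krasner hyperring: a multiplicative monoid with absorbing element `0 ≠ 1`, together
with a multivalued addition making it a canonical hypergroup over which multiplication
distributes. `hadd x y` is the nonempty set `x + y`. -/
class Hyperring (R : Type*) extends MonoidWithZero R where
  hadd : R → R → Set R
  hadd_nonempty : ∀ x y, (hadd x y).Nonempty
  hadd_comm : ∀ x y, hadd x y = hadd y x
  hadd_assoc : ∀ x y z, (⋃ w ∈ hadd x y, hadd w z) = ⋃ w ∈ hadd y z, hadd x w
  zero_hadd : ∀ x, hadd 0 x = {x}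
  existsUnique_neg : ∀ x, ∃! y, (0 : R) ∈ hadd x y
  /-- reversibility: if `x ∈ y + z` and `y'` is the opposite of `y`, then `z ∈ x + y'` -/
  reversible : ∀ x y z y', x ∈ hadd y z → (0 : R) ∈ hadd y y' → z ∈ hadd x y'
  mul_hadd : ∀ r s t, (fun u => r * u) '' hadd s t = hadd (r * s) (r * t)
  hadd_mul : ∀ r s t, (fun u => u * r) '' hadd s t = hadd (s * r) (t * r)
  zero_ne_one' : (0 : R) ≠ 1

/-- Homomorphisms of hyperrings: maps `f` with `f 0 = 0`, `f 1 = 1`, `f (a * b) = f a * f b` and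
`f (a + b) ⊆ f a + f b`. -/
structure HyperringHom (R S : Type*) [Hyperring R] [Hyperring S] extends R →*₀ S where
  map_hadd' : ∀ a b, toFun '' Hyperring.hadd a b ⊆ Hyperring.hadd (toFun a) (toFun b)

namespace HyperringHom

variable {R S T : Type*} [Hyperring R] [Hyperring S] [Hyperring T]

instance : FunLike (HyperringHom R S) R S where
  coe f := f.toFun
  coe_injective f g h := by
    obtain ⟨f, hf⟩ := f
    obtain ⟨g, hg⟩ := g
    have : f = g := DFunLike.coe_injective h
    subst this
    rfl

@[ext] theorem ext {f g : HyperringHom R S} (h : ∀ x, f x = g x) : f = g :=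
  DFunLike.ext _ _ h

/-- Composition of homomorphisms of hyperrings. -/
def comp (g : HyperringHom S T) (f : HyperringHom R S) : HyperringHom R T where
  toMonoidWithZeroHom := g.toMonoidWithZeroHom.comp f.toMonoidWithZeroHom
  map_hadd' a b := by
    rintro _ ⟨x, hx, rfl⟩
    exact g.map_hadd' _ _ ⟨_, f.map_hadd' a b ⟨x, hx, rfl⟩, rfl⟩

end HyperringHom

/-- A nonzero ring is a hyperring, with single-valued addition `x + y = {x + y}`. -/
instance Ring.instHyperring (R : Type*) [Ring R] [Nontrivial R] : Hyperring R where
  hadd x y := {x + y}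
  hadd_nonempty x y := Set.singleton_nonempty _
  hadd_comm x y := by rw [add_comm]
  hadd_assoc x y z := by simp [add_assoc]
  zero_hadd x := by simp
  existsUnique_neg x := ⟨-x, by simp, fun y hy => by
    have : 0 = x + y := hy
    exact (neg_eq_of_add_eq_zero_right this.symm).symm⟩
  reversible x y z y' h h' := by
    have h1 : x = y + z := h
    have h2 : 0 = y + y' := h'
    have h3 : y' = -y := (neg_eq_of_add_eq_zero_right h2.symm).symm
    show z = x + y'
    rw [h1, h3]; abel
  mul_hadd r s t := by simp [mul_add]
  hadd_mul r s t := by simp [add_mul]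
  zero_ne_one' := zero_ne_one

/-- The quotient `R / G` of a commutative ring `R` by a subgroup `G` of its group of units:
the set of orbits of `G` acting on `R` by multiplication. -/
def KrasnerQuotient (R : Type*) [CommRing R] (G : Subgroup Rˣ) : Type _ :=
  MulAction.orbitRel.Quotient G R

namespace KrasnerQuotient

variable {R : Type*} [CommRing R] {G : Subgroup Rˣ}

variable (G) in
/-- The class `x G` of `x` in `R / G`. -/
def mk (x : R) : KrasnerQuotient R G :=
  (Quotient.mk'' x : MulAction.orbitRel.Quotient G R)

theorem mk_surjective : Function.Surjective (mk G) := Quotient.mk''_surjective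

theorem mk_eq_mk_iff {x y : R} : mk G x = mk G y ↔ ∃ g ∈ G, x = (g : Rˣ) * y := by
  constructor
  · intro h
    have h' : (MulAction.orbitRel G R) x y := Quotient.exact h
    obtain ⟨⟨g, hg⟩, hgx⟩ := h'
    exact ⟨g, hg, hgx.symm⟩
  · rintro ⟨g, hg, rfl⟩
    exact Quotient.sound (s := MulAction.orbitRel G R) ⟨⟨g, hg⟩, rfl⟩

theorem mk_smul {g : Rˣ} (hg : g ∈ G) (x : R) : mk G (g * x) = mk G x :=
  mk_eq_mk_iff.2 ⟨g, hg, rfl⟩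

/-- The multiplication `xG * yG = xyG`. -/
instance : CommMonoidWithZero (KrasnerQuotient R G) where
  mul := Quotient.map₂ (fun x y : R => x * y) (by
    rintro _ x ⟨g, rfl⟩ _ y ⟨h, rfl⟩
    refine ⟨g * h, ?_⟩
    show ((g : Rˣ) * (h : Rˣ) : R) * (x * y) = ((g : Rˣ) * x : R) * ((h : Rˣ) * y)
    ring)
  one := mk G 1
  zero := mk G 0
  mul_assoc := by
    intro a b c
    obtain ⟨x, rfl⟩ := mk_surjective a
    obtain ⟨y, rfl⟩ := mk_surjective b
    obtain ⟨z, rfl⟩ := mk_surjective c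
    exact congrArg (mk G) (mul_assoc x y z)
  mul_comm := by
    intro a b
    obtain ⟨x, rfl⟩ := mk_surjective a
    obtain ⟨y, rfl⟩ := mk_surjective b
    exact congrArg (mk G) (mul_comm x y)
  one_mul := by
    intro a
    obtain ⟨x, rfl⟩ := mk_surjective a
    exact congrArg (mk G) (one_mul x)
  mul_one := by
    intro a
    obtain ⟨x, rfl⟩ := mk_surjective a
    exact congrArg (mk G) (mul_one x)
  zero_mul := by
    intro a
    obtain ⟨x, rfl⟩ := mk_surjective a
    exact congrArg (mk G) (zero_mul x)
  mul_zero := by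
    intro a
    obtain ⟨x, rfl⟩ := mk_surjective a
    exact congrArg (mk G) (mul_zero x)

theorem mk_zero : mk G 0 = 0 := rfl

theorem mk_one : mk G 1 = 1 := rfl

theorem mk_mul (x y : R) : mk G (x * y) = mk G x * mk G y := rfl

theorem mk_eq_zero_iff {x : R} : mk G x = 0 ↔ x = 0 := by
  rw [← mk_zero, mk_eq_mk_iff]
  constructor
  · rintro ⟨g, -, rfl⟩
    simp
  · rintro rfl
    exact ⟨1, G.one_mem, by simp⟩

/-- The hyperaddition `(xG + yG) / G`. -/
def add (a b : KrasnerQuotient R G) : Set (KrasnerQuotient R G) :=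
  {c | ∃ x y : R, mk G x = a ∧ mk G y = b ∧ mk G (x + y) = c}

theorem mem_add_mk {x y z : R} :
    mk G z ∈ add (mk G x) (mk G y) ↔ ∃ g ∈ G, ∃ h ∈ G, z = (g : Rˣ) * x + (h : Rˣ) * y := by
  constructor
  · rintro ⟨x', y', hx, hy, hz⟩
    obtain ⟨g, hg, rfl⟩ := mk_eq_mk_iff.1 hx
    obtain ⟨h, hh, rfl⟩ := mk_eq_mk_iff.1 hy
    obtain ⟨k, hk, rfl⟩ := mk_eq_mk_iff.1 hz.symm
    exact ⟨k * g, G.mul_mem hk hg, k * h, G.mul_mem hk hh, by push_cast; ring⟩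
  · rintro ⟨g, hg, h, hh, rfl⟩
    exact ⟨_, _, mk_smul hg x, mk_smul hh y, rfl⟩

instance [Nontrivial R] : Hyperring (KrasnerQuotient R G) where
  hadd := add
  hadd_nonempty a b := by
    obtain ⟨x, rfl⟩ := mk_surjective a
    obtain ⟨y, rfl⟩ := mk_surjective b
    exact ⟨_, x, y, rfl, rfl, rfl⟩
  hadd_comm a b := by
    ext c
    constructor <;> rintro ⟨x, y, hx, hy, h⟩ <;> exact ⟨y, x, hy, hx, by rwa [add_comm]⟩
  hadd_assoc a b c := by
    obtain ⟨x, rfl⟩ := mk_surjective a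
    obtain ⟨y, rfl⟩ := mk_surjective b
    obtain ⟨z, rfl⟩ := mk_surjective c
    ext d
    obtain ⟨t, rfl⟩ := mk_surjective d
    simp only [Set.mem_iUnion, exists_prop]
    constructor
    · rintro ⟨w, hw, ht⟩
      obtain ⟨w, rfl⟩ := mk_surjective w
      obtain ⟨g, hg, h, hh, rfl⟩ := mem_add_mk.1 hw
      obtain ⟨k, hk, l, hl, rfl⟩ := mem_add_mk.1 ht
      refine ⟨mk G ((k * h : Rˣ) * y + (l : Rˣ) * z),
        mem_add_mk.2 ⟨_, G.mul_mem hk hh, _, hl, rfl⟩,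
        mem_add_mk.2 ⟨k * g, G.mul_mem hk hg, 1, G.one_mem, ?_⟩⟩
      push_cast; ring
    · rintro ⟨w, hw, ht⟩
      obtain ⟨w, rfl⟩ := mk_surjective w
      obtain ⟨g, hg, h, hh, rfl⟩ := mem_add_mk.1 hw
      obtain ⟨k, hk, l, hl, rfl⟩ := mem_add_mk.1 ht
      refine ⟨mk G ((k : Rˣ) * x + (l * g : Rˣ) * y),
        mem_add_mk.2 ⟨_, hk, _, G.mul_mem hl hg, rfl⟩,
        mem_add_mk.2 ⟨1, G.one_mem, l * h, G.mul_mem hl hh, ?_⟩⟩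
      push_cast; ring
  zero_hadd a := by
    ext c
    constructor
    · rintro ⟨x, y, hx, rfl, rfl⟩
      have : x = 0 := mk_eq_zero_iff.1 hx
      simp [this]
    · rintro rfl
      obtain ⟨y, rfl⟩ := mk_surjective c
      exact ⟨0, y, rfl, rfl, by simp⟩
  existsUnique_neg a := by
    obtain ⟨x, rfl⟩ := mk_surjective a
    refine ⟨mk G (-x), ⟨x, -x, rfl, rfl, by simp [mk_zero]⟩, ?_⟩
    rintro b ⟨x', y, hx, rfl, h0⟩
    obtain ⟨g, hg, rfl⟩ := mk_eq_mk_iff.1 hx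
    have h : (g : R) * x + y = 0 := mk_eq_zero_iff.1 h0
    exact mk_eq_mk_iff.2 ⟨g, hg, by linear_combination h⟩
  reversible a b c b' h h' := by
    obtain ⟨x, y, rfl, rfl, rfl⟩ := h
    obtain ⟨x', y', hx, rfl, h0⟩ := h'
    obtain ⟨g, hg, rfl⟩ := mk_eq_mk_iff.1 hx
    have h : (g : R) * x + y' = 0 := mk_eq_zero_iff.1 h0
    refine mem_add_mk.2 ⟨1, G.one_mem, g⁻¹, G.inv_mem hg, ?_⟩
    have h2 : y' = -((g : R) * x) := by linear_combination h
    rw [h2, mul_neg, Units.inv_mul_cancel_left]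
    simp
  mul_hadd r s t := by
    obtain ⟨r, rfl⟩ := mk_surjective r
    obtain ⟨s, rfl⟩ := mk_surjective s
    obtain ⟨t, rfl⟩ := mk_surjective t
    ext c
    obtain ⟨z, rfl⟩ := mk_surjective c
    rw [← mk_mul, ← mk_mul, mem_add_mk]
    constructor
    · rintro ⟨_, ⟨x, y, hx, hy, rfl⟩, hz⟩
      obtain ⟨g, hg, rfl⟩ := mk_eq_mk_iff.1 hx
      obtain ⟨h, hh, rfl⟩ := mk_eq_mk_iff.1 hy
      obtain ⟨k, hk, rfl⟩ := mk_eq_mk_iff.1 hz.symm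
      exact ⟨k * g, G.mul_mem hk hg, k * h, G.mul_mem hk hh, by push_cast; ring⟩
    · rintro ⟨g, hg, h, hh, rfl⟩
      refine ⟨_, ⟨_, _, mk_smul hg s, mk_smul hh t, rfl⟩, ?_⟩
      show mk G (r * _) = _
      congr 1; ring
  hadd_mul r s t := by
    obtain ⟨r, rfl⟩ := mk_surjective r
    obtain ⟨s, rfl⟩ := mk_surjective s
    obtain ⟨t, rfl⟩ := mk_surjective t
    ext c
    obtain ⟨z, rfl⟩ := mk_surjective c
    rw [← mk_mul, ← mk_mul, mem_add_mk]
    constructor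
    · rintro ⟨_, ⟨x, y, hx, hy, rfl⟩, hz⟩
      obtain ⟨g, hg, rfl⟩ := mk_eq_mk_iff.1 hx
      obtain ⟨h, hh, rfl⟩ := mk_eq_mk_iff.1 hy
      obtain ⟨k, hk, rfl⟩ := mk_eq_mk_iff.1 hz.symm
      exact ⟨k * g, G.mul_mem hk hg, k * h, G.mul_mem hk hh, by push_cast; ring⟩
    · rintro ⟨g, hg, h, hh, rfl⟩
      refine ⟨_, ⟨_, _, mk_smul hg s, mk_smul hh t, rfl⟩, ?_⟩
      show mk G (_ * r) = _
      congr 1; ring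
  zero_ne_one' h := one_ne_zero (mk_eq_zero_iff.1 h.symm)

end KrasnerQuotient

/-- The subgroup of the units of a `K`-algebra `A` formed by the images of the nonzero scalars. -/
def scalarUnits (K A : Type*) [Field K] [CommRing A] [Algebra K A] : Subgroup Aˣ :=
  (Units.map (algebraMap K A : K →* A)).range

/-- The hyperring `A / Kˣ` of a commutative algebra `A` over a field `K`. -/
abbrev ScalarQuotient (K A : Type*) [Field K] [CommRing A] [Algebra K A] : Type _ :=
  KrasnerQuotient A (scalarUnits K A)

namespace ScalarQuotient

variable {K A B : Type*} [Field K] [CommRing A] [Algebra K A] [Nontrivial A]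
  [CommRing B] [Algebra K B] [Nontrivial B]

/-- A ring homomorphism `f : R → A` induces a hyperring homomorphism `R → A / Kˣ`,
`x ↦ f x Kˣ`. -/
def ofRingHom (K : Type*) [Field K] [Algebra K A] {R : Type*} [Ring R] [Nontrivial R]
    (f : R →+* A) : HyperringHom R (ScalarQuotient K A) where
  toFun x := KrasnerQuotient.mk _ (f x)
  map_zero' := by rw [map_zero]; rfl
  map_one' := by rw [map_one]; rfl
  map_mul' x y := by rw [map_mul]; rfl
  map_hadd' x y := by
    rintro _ ⟨_, rfl, rfl⟩
    exact ⟨f x, f y, rfl, rfl, by rw [← map_add]⟩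

/-- A homomorphism of `K`-algebras `f : A → B` induces a hyperring homomorphism
`A / Kˣ → B / Kˣ`, `x Kˣ ↦ f x Kˣ`. -/
def map (f : A →ₐ[K] B) : HyperringHom (ScalarQuotient K A) (ScalarQuotient K B) where
  toFun := Quotient.lift (fun x => KrasnerQuotient.mk (scalarUnits K B) (f x)) (by
    rintro _ y ⟨⟨_, ⟨c, rfl⟩⟩, rfl⟩
    refine KrasnerQuotient.mk_eq_mk_iff.2 ⟨_, ⟨c, rfl⟩, ?_⟩
    show f (algebraMap K A c * y) = algebraMap K B c * f y
    rw [map_mul, AlgHom.commutes])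
  map_zero' := congrArg (KrasnerQuotient.mk _) (map_zero f)
  map_one' := congrArg (KrasnerQuotient.mk _) (map_one f)
  map_mul' a b := by
    obtain ⟨x, rfl⟩ := KrasnerQuotient.mk_surjective a
    obtain ⟨y, rfl⟩ := KrasnerQuotient.mk_surjective b
    exact congrArg (KrasnerQuotient.mk _) (map_mul f x y)
  map_hadd' a b := by
    rintro _ ⟨_, ⟨x, y, rfl, rfl, rfl⟩, rfl⟩
    exact ⟨f x, f y, rfl, rfl, congrArg (KrasnerQuotient.mk _) (map_add f x y).symm⟩

theorem map_mk (f : A →ₐ[K] B) (x : A) :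
    map f (KrasnerQuotient.mk _ x) = KrasnerQuotient.mk _ (f x) := rfl

end ScalarQuotient

/-- The ring of adèles of `ℚ`: the product of the completions at the infinite places and of the
restricted product of the completions at the finite places. -/
abbrev RatAdeles : Type := AdeleRing ℤ ℚ

instance : Nontrivial RatAdeles :=
  (AdeleRing.algebraMap_injective ℤ ℚ).nontrivial

/-- The adèle class space `𝔸_ℚ / ℚˣ`, as a hyperring. -/
abbrev RatAdeleClasses : Type := ScalarQuotient ℚ RatAdeles

/-- The places of `ℚ`: the infinite ones and the finite ones. -/
abbrev RatPlace : Type := InfinitePlace ℚ ⊕ HeightOneSpectrum ℤ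

open Classical in
/-- The idempotent adèle `e_Z` of a set `Z` of places: its component is `1` at the places of `Z`
and `0` at the other places. -/
def idempotentAdele (Z : Set RatPlace) : RatAdeles :=
  (fun v => if Sum.inl v ∈ Z then 1 else 0,
   ⟨fun v => if Sum.inr v ∈ Z then 1 else 0, Filter.Eventually.of_forall fun v => by
      show (if Sum.inr v ∈ Z then 1 else 0) ∈ v.adicCompletionIntegers ℚ
      split_ifs
      · exact one_mem _
      · exact zero_mem _⟩)

/-- The subalgebra `ℚ[e_Z]` of the adèles generated by `e_Z`. -/
abbrev idempotentSubalgebra (Z : Set RatPlace) : Subalgebra ℚ RatAdeles :=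
  Algebra.adjoin ℚ {idempotentAdele Z}

/-- The homomorphism `ξ_a : ℤ[T] → 𝔸_ℚ / ℚˣ`, `P ↦ P(a) ℚˣ`. -/
def evalClass (a : RatAdeles) : HyperringHom ℤ[X] RatAdeleClasses :=
  ScalarQuotient.ofRingHom ℚ (aeval a : ℤ[X] →ₐ[ℤ] RatAdeles).toRingHom

theorem evalClass_apply (a : RatAdeles) (P : ℤ[X]) :
    evalClass a P = KrasnerQuotient.mk _ (aeval a P) := rfl

end

/-!
Let `x` represent `ρ T`. The proof is the fundamental theorem of projective geometry for the map
`ρ`, which sends the line through `P` and `Q` into the line through `ρ P` and `ρ Q`.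

If `1`, `x`, `x ^ 2` are linearly independent over `ℚ`, rescale `x` so that `ρ (T + 1)` is the class
of `x + 1`. Multiplicativity gives further relations, such as
`(T + n) * (T + 1) = T * (T + (n + 1)) + n`, which force `ρ (T + n)` to be the class of `x + n` and
`ρ n` that of `n` (`HyperringHom.apply_X_add_intCast`, `HyperringHom.apply_intCast`); in particular
no prime number is sent to `0`. A class `ρ (P + Q)` is then determined by intersecting two lines
inside an independent triple (`HyperringHom.apply_add_of_triangle`), and Horner's scheme
`P = T * Q + n` yields `ρ P = P(x) ℚˣ` for all `P`, by induction on the degree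
(`HyperringHom.apply_X_mul_add_intCast`, `HyperringHom.apply_eq_cls_aeval`). The normalisation of
`x` also shows uniqueness. This works over any `ℚ`-algebra.

If they are dependent, `x` is rational or a root of a rational quadratic polynomial. Completing the
square gives an adèle `z` with `z ^ 2 = d` rational. Then `d` is a square in `ℚ`: all its valuations
are even and it is nonnegative at the real place (`RatAdeles.exists_eq_sq_of_sq_eq`). As the
components of an adèle lie in fields, `z` is a rational multiple of some `2 * e_Z - 1`, so
`x ∈ ℚ[e_Z]` (`RatAdeles.exists_mem_idempotentSubalgebra`). The elements of `ℤ[T]` with class in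
the image of `ℚ[e_Z]` form a subring containing `T`, whence the factorisation of `ρ`
(`HyperringHom.exists_eq_comp_map_val`).
-/

/-! ### Linear algebra -/

/-- Comparison of coefficients with respect to three independent vectors. -/
theorem coeff_eq_of_linearIndependent {V : Type*} [AddCommGroup V] [Module ℚ V] {p r u : V}
    (hli : LinearIndependent ℚ ![p, r, u]) {a b c a' b' c' : ℚ}
    (h : a • p + b • r + c • u = a' • p + b' • r + c' • u) : a = a' ∧ b = b' ∧ c = c' := by
  have h0 := Fintype.linearIndependent_iff.1 hli ![a - a', b - b', c - c'] (by
    simp only [Fin.sum_univ_three, Matrix.cons_val_zero, Matrix.cons_val_one, Matrix.cons_val]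
    rw [← sub_eq_zero] at h
    rw [← h]
    module)
  have h1 := h0 0
  have h2 := h0 1
  have h3 := h0 2
  simp only [Matrix.cons_val_zero, Matrix.cons_val_one, Matrix.cons_val, sub_eq_zero] at h1 h2 h3
  exact ⟨h1, h2, h3⟩

theorem linearIndependent_of_notMem_span_pair {V : Type*} [AddCommGroup V] [Module ℚ V]
    {y u v : V} (huv : LinearIndependent ℚ ![u, v]) (hy : y ∉ Submodule.span ℚ {u, v})
    {r : ℚ} (hr : r ≠ 0) :
    LinearIndependent ℚ ![y, r • u, v] := by
  rw [LinearIndependent.pair_iff] at huv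
  refine Fintype.linearIndependent_iff.2 fun g hg => ?_
  simp only [Fin.sum_univ_three, Matrix.cons_val_zero, Matrix.cons_val_one, Matrix.cons_val] at hg
  have h0 : g 0 = 0 := by
    by_contra h0
    refine hy (Submodule.mem_span_pair.2 ⟨-(g 0)⁻¹ * (g 1 * r), -(g 0)⁻¹ * g 2, ?_⟩)
    have := congrArg (fun z => (g 0)⁻¹ • z) hg
    simp only [smul_add, smul_zero, smul_smul, inv_mul_cancel₀ h0, one_smul] at this
    linear_combination (norm := module) -this
  rw [h0, zero_smul, zero_add, smul_smul] at hg
  obtain ⟨h1, h2⟩ := huv _ _ hg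
  have h1' : g 1 = 0 := by simpa [hr] using h1
  intro i
  fin_cases i
  exacts [h0, h1', h2]

theorem linearIndependent_powers_smul {A : Type*} [CommRing A] [Algebra ℚ A] {x : A}
    {c : ℚ} (hc : c ≠ 0) (hli : LinearIndependent ℚ ![1, x, x ^ 2]) :
    LinearIndependent ℚ ![1, c • x, (c • x) ^ 2] := by
  refine Fintype.linearIndependent_iff.2 fun g hg => ?_
  simp only [Fin.sum_univ_three, Matrix.cons_val_zero, Matrix.cons_val_one, Matrix.cons_val,
    _root_.smul_pow, smul_smul] at hg
  obtain ⟨h0, h1, h2⟩ := coeff_eq_of_linearIndependent hli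
    (a := g 0) (b := g 1 * c) (c := g 2 * c ^ 2) (a' := 0) (b' := 0) (c' := 0) (by simpa using hg)
  intro i
  fin_cases i
  · exact h0
  · simpa [hc] using h1
  · simpa [hc] using h2

/-! ### Classes modulo the nonzero rational scalars -/

namespace ScalarQuotient

variable {A : Type*} [CommRing A] [Algebra ℚ A]

/-- The class `x ℚˣ` of an element `x` of a `ℚ`-algebra. -/
abbrev cls (x : A) : ScalarQuotient ℚ A := KrasnerQuotient.mk (scalarUnits ℚ A) x

theorem cls_eq_iff {x y : A} : cls x = cls y ↔ ∃ c : ℚ, c ≠ 0 ∧ x = c • y := by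
  rw [cls, cls, KrasnerQuotient.mk_eq_mk_iff]
  constructor
  · rintro ⟨_, ⟨c, rfl⟩, rfl⟩
    exact ⟨c, c.ne_zero, (Algebra.smul_def _ _).symm⟩
  · rintro ⟨c, hc, rfl⟩
    exact ⟨_, ⟨Units.mk0 c hc, rfl⟩, Algebra.smul_def _ _⟩

theorem cls_smul {c : ℚ} (hc : c ≠ 0) (x : A) : cls (c • x) = cls x :=
  cls_eq_iff.2 ⟨c, hc, rfl⟩

theorem cls_neg (x : A) : cls (-x) = cls x :=
  cls_eq_iff.2 ⟨-1, by norm_num, by simp⟩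

theorem cls_mul (x y : A) : cls (x * y) = cls x * cls y := rfl

theorem exists_cls (c : ScalarQuotient ℚ A) : ∃ x : A, c = cls x :=
  (KrasnerQuotient.mk_surjective c).imp fun _ h => h.symm

variable [Nontrivial A]

theorem mem_hadd_cls {x y z : A} : cls z ∈ Hyperring.hadd (cls x) (cls y) ↔
    ∃ s t : ℚ, s ≠ 0 ∧ t ≠ 0 ∧ z = s • x + t • y := by
  refine KrasnerQuotient.mem_add_mk.trans ⟨?_, ?_⟩
  · rintro ⟨_, ⟨s, rfl⟩, _, ⟨t, rfl⟩, rfl⟩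
    exact ⟨s, t, s.ne_zero, t.ne_zero, by rw [Algebra.smul_def, Algebra.smul_def]; rfl⟩
  · rintro ⟨s, t, hs, ht, rfl⟩
    exact ⟨_, ⟨Units.mk0 s hs, rfl⟩, _, ⟨Units.mk0 t ht, rfl⟩, by
      rw [Algebra.smul_def, Algebra.smul_def]; rfl⟩

end ScalarQuotient

open ScalarQuotient

/-! ### Hyperring homomorphisms to `A / ℚˣ` -/

namespace HyperringHom

variable {A : Type*} [CommRing A] [Algebra ℚ A] [Nontrivial A]

theorem apply_mul {R S : Type*} [Hyperring R] [Hyperring S] (ρ : HyperringHom R S) (x y : R) :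
    ρ (x * y) = ρ x * ρ y :=
  ρ.map_mul' x y

section Ring

variable {R : Type*} [CommRing R] [Nontrivial R] (ρ : HyperringHom R (ScalarQuotient ℚ A))

theorem apply_zero : ρ 0 = cls 0 := ρ.map_zero'

theorem apply_one : ρ 1 = cls 1 := ρ.map_one'

variable {ρ}

theorem apply_mul_eq {P Q : R} {p q : A} (hP : ρ P = cls p) (hQ : ρ Q = cls q) :
    ρ (P * Q) = cls (p * q) := by
  rw [apply_mul, hP, hQ, cls_mul]

theorem exists_apply_add {P Q : R} {p q : A} (hP : ρ P = cls p) (hQ : ρ Q = cls q) :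
    ∃ s t : ℚ, s ≠ 0 ∧ t ≠ 0 ∧ ρ (P + Q) = cls (s • p + t • q) := by
  obtain ⟨z, hz⟩ := exists_cls (ρ (P + Q))
  have h : ρ (P + Q) ∈ Hyperring.hadd (ρ P) (ρ Q) := ρ.map_hadd' P Q ⟨P + Q, rfl, rfl⟩
  rw [hz, hP, hQ, mem_hadd_cls] at h
  obtain ⟨s, t, hs, ht, rfl⟩ := h
  exact ⟨s, t, hs, ht, hz⟩

/-- Dividing by the first coefficient, one may keep the given representative of `ρ P`. -/
theorem exists_apply_add' {P Q : R} {p q : A} (hP : ρ P = cls p) (hQ : ρ Q = cls q) :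
    ∃ t : ℚ, t ≠ 0 ∧ ρ (P + Q) = cls (p + t • q) := by
  obtain ⟨s, t, hs, ht, h⟩ := exists_apply_add hP hQ
  refine ⟨s⁻¹ * t, by positivity, ?_⟩
  rw [h, ← cls_smul (inv_ne_zero hs), smul_add, smul_smul, smul_smul, inv_mul_cancel₀ hs,
    one_smul]

variable (ρ)

/-- From `0 ∈ 1 + ρ (-1)` one gets `ρ (-1) = 1`, as `-1` is a scalar. -/
theorem apply_neg (P : R) : ρ (-P) = ρ P := by
  have h : ρ (-1) = cls 1 := by
    obtain ⟨e, he⟩ := exists_cls (ρ (-1))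
    obtain ⟨t, ht, h⟩ := exists_apply_add' (apply_one ρ) he
    rw [add_neg_cancel, apply_zero, cls_eq_iff] at h
    obtain ⟨c, hc, h⟩ := h
    have h' : (1 : A) + t • e = 0 := (smul_eq_zero_iff_right hc).1 h.symm
    rw [he, ← cls_smul ht, ← cls_neg]
    congr 1
    exact neg_eq_of_add_eq_zero_left h'
  obtain ⟨p, hp⟩ := exists_cls (ρ P)
  rw [← neg_one_mul, apply_mul_eq h hp, one_mul, hp]

/-- The subring of the elements of `R` whose value under `ρ` is the class of an element of the
subalgebra `B`. -/
def comapSubalgebra (B : Subalgebra ℚ A) : Subring R where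
  carrier := {P | ∃ b ∈ B, ρ P = cls b}
  mul_mem' := by
    rintro P Q ⟨p, hp, hP⟩ ⟨q, hq, hQ⟩
    exact ⟨p * q, mul_mem hp hq, apply_mul_eq hP hQ⟩
  one_mem' := ⟨1, one_mem _, apply_one ρ⟩
  add_mem' := by
    rintro P Q ⟨p, hp, hP⟩ ⟨q, hq, hQ⟩
    obtain ⟨s, t, -, -, h⟩ := exists_apply_add hP hQ
    exact ⟨_, add_mem (B.smul_mem hp s) (B.smul_mem hq t), h⟩
  zero_mem' := ⟨0, zero_mem _, apply_zero ρ⟩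
  neg_mem' := by
    rintro P ⟨p, hp, hP⟩
    exact ⟨p, hp, by rw [apply_neg, hP]⟩

theorem exists_apply_intCast (n : ℤ) : ∃ k : ℚ, ρ (n : R) = cls (k • 1 : A) := by
  obtain ⟨b, hb, h⟩ := intCast_mem (comapSubalgebra ρ ⊥) n
  obtain ⟨k, rfl⟩ := Algebra.mem_bot.1 hb
  exact ⟨k, by rw [h, Algebra.algebraMap_eq_smul_one]⟩

variable {ρ}

/-- If every value of `ρ` is the class of an element of a subalgebra `B`, then `ρ` factors through
`B / ℚˣ`: two elements of `B` proportional in `A` are so in `B`. -/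
theorem exists_eq_comp_map_val (B : Subalgebra ℚ A) (h : ∀ P, ∃ b ∈ B, ρ P = cls b) :
    ∃ σ : HyperringHom R (ScalarQuotient ℚ B), ρ = (ScalarQuotient.map B.val).comp σ := by
  have h' : ∀ P, ∃ b : B, ρ P = cls (b : A) := fun P =>
    (h P).elim fun b hb => ⟨⟨b, hb.1⟩, hb.2⟩
  choose g hg using h'
  have inj : ∀ b c : B, cls (b : A) = cls (c : A) → cls b = cls c := by
    intro b c hbc
    obtain ⟨r, hr, e⟩ := cls_eq_iff.1 hbc
    exact cls_eq_iff.2 ⟨r, hr, Subtype.ext e⟩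
  refine ⟨{
    toFun := fun P => cls (g P)
    map_zero' := ?_
    map_one' := ?_
    map_mul' := ?_
    map_hadd' := ?_ }, ?_⟩
  · exact inj _ 0 ((hg 0).symm.trans (apply_zero ρ))
  · exact inj _ 1 ((hg 1).symm.trans (apply_one ρ))
  · exact fun P Q => inj _ (g P * g Q) ((hg _).symm.trans (apply_mul_eq (hg P) (hg Q)))
  · rintro P Q _ ⟨_, rfl, rfl⟩
    obtain ⟨s, t, hs, ht, e⟩ := exists_apply_add (hg P) (hg Q)
    have e' : cls (g (P + Q)) = cls (s • g P + t • g Q) := inj _ _ ((hg _).symm.trans e)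
    change cls (g (P + Q)) ∈ _
    rw [e']
    exact mem_hadd_cls.2 ⟨s, t, hs, ht, rfl⟩
  · exact HyperringHom.ext hg

end Ring

/-- The triangle argument of projective geometry: the class of `P + Q` is determined by the classes
of `P`, `Q`, `U`, `P + U`, `Q + U` when those of `P`, `Q`, `U` are independent, because the line
through `P` and `Q + U` and the line through `P + U` and `Q` meet in one point. -/
theorem apply_add_of_triangle {R : Type*} [CommRing R] [Nontrivial R]
    {ρ : HyperringHom R (ScalarQuotient ℚ A)} {P Q U : R} {p q u : A}
    (hli : LinearIndependent ℚ ![p, q, u]) (hP : ρ P = cls p) (hQ : ρ Q = cls q)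
    (hU : ρ U = cls u) (hPU : ρ (P + U) = cls (p + u)) (hQU : ρ (Q + U) = cls (q + u)) :
    ρ (P + Q) = cls (p + q) := by
  obtain ⟨a, ha, h1⟩ := exists_apply_add' hP hQU
  obtain ⟨b, hb, h2⟩ := exists_apply_add' hPU hQ
  obtain ⟨c, hc, h3⟩ := exists_apply_add' hP hQ
  obtain ⟨d, hd, h4⟩ := exists_apply_add' h3 hU
  rw [show P + U + Q = P + (Q + U) by ring, h1, cls_eq_iff] at h2
  rw [show P + Q + U = P + (Q + U) by ring, h1, cls_eq_iff] at h4
  obtain ⟨k, hk, h2⟩ := h2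
  obtain ⟨l, hl, h4⟩ := h4
  obtain ⟨e1, e2, e3⟩ := coeff_eq_of_linearIndependent hli
    (a := 1) (b := a) (c := a) (a' := k) (b' := k * b) (c' := k)
    (by rw [show k • p + (k * b) • q + k • u = k • (p + u + b • q) by module, ← h2]; module)
  obtain ⟨f1, f2, f3⟩ := coeff_eq_of_linearIndependent hli
    (a := 1) (b := a) (c := a) (a' := l) (b' := l * c) (c' := l * d)
    (by rw [show l • p + (l * c) • q + (l * d) • u = l • (p + c • q + d • u) by module, ← h4]
        module)
  have : c = 1 := by
    rw [← f1, one_mul, e3, ← e1] at f2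
    exact f2.symm
  rw [h3, this, one_smul]

/-! ### Polynomials: the non-degenerate case -/

section Polynomial

variable {ρ : HyperringHom ℤ[X] (ScalarQuotient ℚ A)} {x : A}

/-- If `1`, `x`, `x ^ 2` are independent, then the classes of `T` and `T + 1` determine those of
all `T + n`: compare `T * (T + (n + 1))` with `(T + n) * (T + 1)`, which differ by a constant. -/
theorem apply_X_add_intCast (hli : LinearIndependent ℚ ![1, x, x ^ 2]) (hX : ρ X = cls x)
    (hX1 : ρ (X + 1) = cls (x + 1)) (n : ℤ) :
    ρ (X + (n : ℤ[X])) = cls (x + (n : ℚ) • (1 : A)) := by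
  induction n with
  | zero => simpa using hX
  | succ n ih =>
    obtain ⟨k, hk⟩ := exists_apply_intCast ρ (-n)
    obtain ⟨l, hl⟩ := exists_apply_intCast ρ (n + 1)
    obtain ⟨m, -, hm⟩ := exists_apply_add' hX hl
    obtain ⟨s, t, -, -, h⟩ := exists_apply_add (apply_mul_eq ih hX1) hk
    have e : (X + ((n : ℤ) : ℤ[X])) * (X + 1) + ((-n : ℤ) : ℤ[X])
        = X * (X + ((n + 1 : ℤ) : ℤ[X])) := by
      push_cast; ring
    rw [e, apply_mul_eq hX hm, cls_eq_iff] at h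
    obtain ⟨c, -, h⟩ := h
    obtain ⟨-, e1, e2⟩ := coeff_eq_of_linearIndependent hli
      (a := 0) (b := m * l) (c := 1) (a' := c * s * n + c * t * k) (b' := c * s * (n + 1))
      (c' := c * s) (by
        rw [Int.cast_natCast] at h
        simp only [Algebra.smul_def, map_add, map_mul, map_one, map_natCast, map_zero] at h ⊢
        linear_combination h)
    rw [hm, smul_smul, e1, ← e2]
    push_cast
    rw [one_mul]
  | pred n ih =>
    obtain ⟨k, hk⟩ := exists_apply_intCast ρ (-n - 1)
    obtain ⟨m, -, hm⟩ := exists_apply_add' hX hk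
    obtain ⟨s, t, -, -, h⟩ := exists_apply_add (apply_mul_eq hX ih) hk
    have e : X * (X + ((-n : ℤ) : ℤ[X])) + ((-n - 1 : ℤ) : ℤ[X])
        = (X + ((-n - 1 : ℤ) : ℤ[X])) * (X + 1) := by
      push_cast; ring
    rw [e, apply_mul_eq hm hX1, cls_eq_iff] at h
    obtain ⟨c, -, h⟩ := h
    obtain ⟨-, e1, e2⟩ := coeff_eq_of_linearIndependent hli
      (a := m * k) (b := m * k + 1) (c := 1) (a' := c * t * k) (b' := c * s * (-n)) (c' := c * s)
      (by
        rw [Int.cast_neg, Int.cast_natCast] at h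
        simp only [Algebra.smul_def, map_add, map_mul, map_one, map_neg, map_natCast] at h ⊢
        linear_combination h)
    rw [← e2] at e1
    rw [hm, smul_smul, show m * k = ((-n - 1 : ℤ) : ℚ) by push_cast; linarith]

/-- Comparing `ρ (T + n) = (x + n) ℚˣ` with `ρ T + ρ n` shows that `ρ n ≠ 0` for `n ≠ 0`, so the
kernel of `ρ` contains no prime number. -/
theorem apply_intCast (hli : LinearIndependent ℚ ![1, x, x ^ 2]) (hX : ρ X = cls x)
    (hX1 : ρ (X + 1) = cls (x + 1)) (n : ℤ) :
    ρ (n : ℤ[X]) = cls ((n : ℚ) • (1 : A)) := by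
  rcases eq_or_ne n 0 with rfl | hn
  · simpa using apply_zero ρ
  obtain ⟨k, hk⟩ := exists_apply_intCast ρ n
  obtain ⟨t, ht, h⟩ := exists_apply_add' hX hk
  rw [apply_X_add_intCast hli hX hX1, cls_eq_iff] at h
  obtain ⟨c, hc, h⟩ := h
  obtain ⟨e, -, -⟩ := coeff_eq_of_linearIndependent hli
    (a := n) (b := 1) (c := 0) (a' := c * t * k) (b' := c) (c' := 0) (by
      rw [smul_add] at h
      linear_combination (norm := module) h)
  have hk0 : k ≠ 0 := by
    rintro rfl
    rw [mul_zero] at e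
    exact hn (by exact_mod_cast e)
  rw [hk, cls_smul hk0, cls_smul (by exact_mod_cast hn)]

/-- Horner step off the plane spanned by `1` and `x`: the triangle argument with third vertex
`T`. -/
theorem apply_X_mul_add_intCast_of_notMem (hli : LinearIndependent ℚ ![1, x, x ^ 2])
    (hX : ρ X = cls x) (hX1 : ρ (X + 1) = cls (x + 1)) {Q : ℤ[X]} {q : A}
    (hQ : ρ Q = cls q) (hQ1 : ρ (Q + 1) = cls (q + 1))
    (hq : x * q ∉ Submodule.span ℚ {1, x}) (n : ℤ) :
    ρ (X * Q + (n : ℤ[X])) = cls (x * q + (n : ℚ) • (1 : A)) := by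
  rcases eq_or_ne n 0 with rfl | hn
  · simpa using apply_mul_eq hX hQ
  have h1x : LinearIndependent ℚ ![1, x] := by
    refine LinearIndependent.pair_iff.2 fun s t h => ?_
    obtain ⟨e1, e2, -⟩ := coeff_eq_of_linearIndependent hli
      (a := s) (b := t) (c := 0) (a' := 0) (b' := 0) (c' := 0) (by simpa using h)
    exact ⟨e1, e2⟩
  refine apply_add_of_triangle
    (linearIndependent_of_notMem_span_pair h1x hq (by exact_mod_cast hn : (n : ℚ) ≠ 0))
    (apply_mul_eq hX hQ) (apply_intCast hli hX hX1 n) hX ?_ ?_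
  · rw [show X * Q + X = X * (Q + 1) by ring, show x * q + x = x * (q + 1) by ring]
    exact apply_mul_eq hX hQ1
  · rw [add_comm, apply_X_add_intCast hli hX hX1, add_comm]

/-- Horner step. When `x * q` lies in the span of `1` and `x`, one passes through
`T * (Q + T) + n`, whose value is off that plane, and subtracts `T ^ 2`. -/
theorem apply_X_mul_add_intCast (hli : LinearIndependent ℚ ![1, x, x ^ 2])
    (hX : ρ X = cls x) (hX1 : ρ (X + 1) = cls (x + 1)) {Q : ℤ[X]} {q : A}
    (hQ : ρ Q = cls q) (hQ1 : ρ (Q + 1) = cls (q + 1)) (hQX : ρ (Q + X) = cls (q + x))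
    (hQX1 : ρ (Q + X + 1) = cls (q + x + 1)) (n : ℤ) :
    ρ (X * Q + (n : ℤ[X])) = cls (x * q + (n : ℚ) • (1 : A)) := by
  by_cases hq : x * q ∈ Submodule.span ℚ {1, x}
  swap
  · exact apply_X_mul_add_intCast_of_notMem hli hX hX1 hQ hQ1 hq n
  obtain ⟨α, β, hαβ⟩ := Submodule.mem_span_pair.1 hq
  have hq' : x * (q + x) ∉ Submodule.span ℚ {1, x} := by
    intro h
    obtain ⟨α', β', h⟩ := Submodule.mem_span_pair.1 h
    obtain ⟨-, -, e⟩ := coeff_eq_of_linearIndependent hli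
      (a := α) (b := β) (c := 1) (a' := α') (b' := β') (c' := 0) (by
        rw [hαβ, zero_smul, add_zero, h, one_smul]; ring)
    exact one_ne_zero e
  have h1 := apply_X_mul_add_intCast_of_notMem hli hX hX1 hQX hQX1 hq' n
  -- `-(T ^ 2)` and `T ^ 2` have the same class, so subtracting is adding a multiple of `x ^ 2`.
  have h2 : ρ (-(X * X)) = cls (x * x) := by rw [apply_neg, apply_mul_eq hX hX]
  obtain ⟨s, t, hs, -, h3⟩ := exists_apply_add h1 h2
  obtain ⟨s', t', -, -, h4⟩ := exists_apply_add (apply_mul_eq hX hQ) (apply_intCast hli hX hX1 n)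
  rw [show X * (Q + X) + (n : ℤ[X]) + -(X * X) = X * Q + (n : ℤ[X]) by ring] at h3
  have h5 := h3
  rw [h4, cls_eq_iff] at h5
  obtain ⟨c, hc, h5⟩ := h5
  obtain ⟨-, -, e⟩ := coeff_eq_of_linearIndependent hli
    (a := s' * α + t' * n) (b := s' * β) (c := 0)
    (a' := c * s * α + c * s * n) (b' := c * s * β) (c' := c * (s + t)) (by
      rw [mul_add, ← hαβ] at h5
      rw [← pow_two] at h5
      linear_combination (norm := module) h5)
  -- `h4` puts `ρ (T * Q + n)` in the plane of `1` and `x`, so the terms in `x ^ 2` of `h3` cancel.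
  have hst : t = -s := by
    have := (mul_eq_zero.1 e.symm).resolve_left hc
    linarith
  rw [h3, ← cls_smul hs (x * q + _), hst, mul_add]
  congr 1
  module

/-- With the normalisation `ρ (T + 1) = (x + 1) ℚˣ`, the homomorphism `ρ` is the evaluation at
`x`. -/
theorem apply_eq_cls_aeval (hli : LinearIndependent ℚ ![1, x, x ^ 2])
    (hX : ρ X = cls x) (hX1 : ρ (X + 1) = cls (x + 1)) (P : ℤ[X]) : ρ P = cls (aeval x P) := by
  have horner : ∀ (Q : ℤ[X]) (n : ℤ), ρ Q = cls (aeval x Q) → ρ (Q + 1) = cls (aeval x (Q + 1)) →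
      ρ (Q + X) = cls (aeval x (Q + X)) → ρ (Q + X + 1) = cls (aeval x (Q + X + 1)) →
      ρ (X * Q + (n : ℤ[X])) = cls (aeval x (X * Q + (n : ℤ[X]))) := by
    intro Q n h0 h1 h2 h3
    simp only [map_add, aeval_X, map_one] at h1 h2 h3
    rw [apply_X_mul_add_intCast hli hX hX1 h0 h1 h2 h3 n]
    simp [Algebra.smul_def]
  have const : ∀ n : ℤ, ρ (n : ℤ[X]) = cls (aeval x (n : ℤ[X])) := fun n => by
    rw [apply_intCast hli hX hX1]; simp [Algebra.smul_def]
  have monic : ∀ n : ℤ, ρ ((n : ℤ[X]) + X) = cls (aeval x ((n : ℤ[X]) + X)) := fun n => by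
    rw [add_comm, apply_X_add_intCast hli hX hX1]; simp [Algebra.smul_def]
  -- The Horner step for `Q` uses `Q + T`, so the induction starts with degree at most `1`, where
  -- `Q` is constant and `Q + T` is covered by `monic`.
  have key : ∀ (k : ℕ) (P : ℤ[X]), P.natDegree ≤ k + 1 → ρ P = cls (aeval x P) := by
    intro k
    induction k with
    | zero =>
      intro P hP
      rw [← X_mul_divX_add P, eq_C_of_natDegree_le_zero (p := P.divX)
        (by rw [natDegree_divX_eq_natDegree_tsub_one]; omega)]
      simp only [eq_intCast]
      refine horner _ _ (const _) ?_ (monic _) ?_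
      · exact_mod_cast const (P.divX.coeff 0 + 1)
      · have := monic (P.divX.coeff 0 + 1)
        push_cast at this
        rwa [add_right_comm] at this
    | succ k ih =>
      intro P hP
      have hd : P.divX.natDegree ≤ k + 1 := by
        rw [natDegree_divX_eq_natDegree_tsub_one]; omega
      have hX' : (X : ℤ[X]).natDegree ≤ k + 1 := natDegree_X_le.trans (by omega)
      have h1' : (1 : ℤ[X]).natDegree ≤ k + 1 := by simp
      rw [← X_mul_divX_add P, show (C (P.coeff 0) : ℤ[X]) = ((P.coeff 0 : ℤ) : ℤ[X]) from
        eq_intCast C _]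
      exact horner _ _ (ih _ hd) (ih _ (natDegree_add_le_of_degree_le hd h1'))
        (ih _ (natDegree_add_le_of_degree_le hd hX'))
        (ih _ (natDegree_add_le_of_degree_le (natDegree_add_le_of_degree_le hd hX') h1'))
  exact key P.natDegree P (by omega)

/-- The non-degenerate case: if the values at `1`, `T`, `T ^ 2` are independent, then `ρ` is the
evaluation at a unique element. -/
theorem existsUnique_eval (hX : ρ X = cls x) (hli : LinearIndependent ℚ ![1, x, x ^ 2]) :
    ∃! a : A, ∀ P, ρ P = cls (aeval a P) := by
  obtain ⟨t, ht, h⟩ := exists_apply_add' (apply_one ρ) hX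
  have hX' : ρ X = cls (t • x) := by rw [cls_smul ht, hX]
  have hX1 : ρ (X + 1) = cls (t • x + 1) := by rw [add_comm, h, add_comm]
  have hli' := linearIndependent_powers_smul ht hli
  -- An element with the same evaluations is proportional to `t • x`, and so are the two sums
  -- with `1`; as `1` is independent of `t • x`, the two elements agree.
  refine ⟨t • x, apply_eq_cls_aeval hli' hX' hX1, fun a ha => ?_⟩
  have h1 := ha X
  have h2 := ha (X + 1)
  simp only [map_add, aeval_X, map_one] at h1 h2
  rw [hX', eq_comm, cls_eq_iff] at h1
  rw [hX1, eq_comm, cls_eq_iff] at h2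
  obtain ⟨c, -, rfl⟩ := h1
  obtain ⟨d, -, h2⟩ := h2
  obtain ⟨e1, e2, -⟩ := coeff_eq_of_linearIndependent hli'
    (a := 1) (b := c) (c := 0) (a' := d) (b' := d) (c' := 0) (by
      linear_combination (norm := module) h2)
  rw [e2, ← e1, one_smul]

/-- If `ρ T` is the class of an element of the subalgebra `B`, then so is every value of `ρ`. -/
theorem exists_mem_apply_eq_cls {B : Subalgebra ℚ A} (hx : x ∈ B) (hX : ρ X = cls x) (P : ℤ[X]) :
    ∃ b ∈ B, ρ P = cls b := by
  change P ∈ comapSubalgebra ρ B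
  have hX' : X ∈ comapSubalgebra ρ B := ⟨x, hx, hX⟩
  induction P using Polynomial.induction_on' with
  | add p q hp hq => exact add_mem hp hq
  | monomial n a =>
    rw [← C_mul_X_pow_eq_monomial, show (C a : ℤ[X]) = (a : ℤ[X]) from eq_intCast C a]
    exact mul_mem (intCast_mem _ _) (pow_mem hX' _)

end Polynomial

end HyperringHom

/-! ### Quadratic adèles -/

namespace RatAdeles

theorem ext_places {a b : RatAdeles} (h₁ : ∀ v, a.1 v = b.1 v) (h₂ : ∀ v, a.2 v = b.2 v) :
    a = b :=
  Prod.ext (funext h₁) (DFunLike.ext _ _ h₂)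

theorem eq_zero_of_sq_eq_zero {z : RatAdeles} (h : z ^ 2 = 0) : z = 0 := by
  rw [pow_two] at h
  refine ext_places (fun v => ?_) (fun v => ?_)
  · have h' : z.1 v * z.1 v = 0 := congrArg (fun a : RatAdeles => a.1 v) h
    exact mul_self_eq_zero.1 h'
  · have h' : z.2 v * z.2 v = 0 := congrArg (fun a : RatAdeles => a.2 v) h
    exact mul_self_eq_zero.1 h'

/-- An adèle of square `1` is `±1` at each place. -/
theorem exists_eq_idempotentAdele_of_sq_eq_one {z : RatAdeles} (h : z ^ 2 = 1) :
    ∃ Z, z = 2 * idempotentAdele Z - 1 := by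
  classical
  rw [pow_two] at h
  refine ⟨{v | Sum.elim (fun v => z.1 v = 1) (fun v => z.2 v = 1) v},
    ext_places (fun v => ?_) (fun v => ?_)⟩
  · have h' : z.1 v * z.1 v = 1 := congrArg (fun a : RatAdeles => a.1 v) h
    change z.1 v = 2 * (if z.1 v = 1 then 1 else 0) - 1
    split_ifs with h1
    · rw [h1]; norm_num
    · rw [(mul_self_eq_one_iff.1 h').resolve_left h1]; norm_num
  · have h' : z.2 v * z.2 v = 1 := congrArg (fun a : RatAdeles => a.2 v) h
    change z.2 v = 2 * (if z.2 v = 1 then 1 else 0) - 1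
    split_ifs with h1
    · rw [h1]; norm_num
    · rw [(mul_self_eq_one_iff.1 h').resolve_left h1]; norm_num

/-- The real place excludes minus signs. -/
theorem ne_neg_sq_of_sq_eq {z : RatAdeles} {N b : ℤ} (hb : b ≠ 0)
    (h : z ^ 2 = algebraMap ℚ RatAdeles N) : N ≠ -b ^ 2 := by
  rintro rfl
  have hv : (Rat.infinitePlace).IsReal := Rat.isReal_infinitePlace
  rw [map_intCast, pow_two] at h
  have h1 : z.1 Rat.infinitePlace * z.1 Rat.infinitePlace = ((-b ^ 2 : ℤ) : _) :=
    congrArg (fun a : RatAdeles => a.1 Rat.infinitePlace) h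
  have h2 := congrArg (InfinitePlace.Completion.extensionEmbeddingOfIsReal hv) h1
  rw [map_mul, map_intCast] at h2
  push_cast at h2
  have hb' : (0 : ℝ) < (b : ℝ) ^ 2 := by positivity
  nlinarith [mul_self_nonneg (InfinitePlace.Completion.extensionEmbeddingOfIsReal hv
    (z.1 Rat.infinitePlace))]

/-- The valuation at `p` of an integer `b ^ 2 * (p * m)` with `p ∤ m` is odd. -/
theorem sq_ne_of_prime {z : RatAdeles} {p m b : ℤ} (hp : Prime p) (hm : ¬ p ∣ m) (hb : b ≠ 0) :
    z ^ 2 ≠ algebraMap ℚ RatAdeles ((b ^ 2 * (p * m) : ℤ) : ℚ) := by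
  intro h
  let v : HeightOneSpectrum ℤ := ⟨Ideal.span {p}, (Ideal.span_singleton_prime hp.ne_zero).2 hp,
    by simpa using hp.ne_zero⟩
  rw [pow_two] at h
  have h1 : z.2 v * z.2 v = algebraMap ℚ (v.adicCompletion ℚ) ((b ^ 2 * (p * m) : ℤ) : ℚ) :=
    congrArg (fun a : RatAdeles => a.2 v) h
  have h2 : Valued.v (z.2 v) * Valued.v (z.2 v) = v.intValuation (b ^ 2 * (p * m)) :=
    (map_mul _ _ _).symm.trans <| (congrArg Valued.v h1).trans <|
      (HeightOneSpectrum.valuedAdicCompletion_eq_valuation' _ _).trans (v.valuation_of_algebraMap _)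
  rw [map_mul, map_pow, map_mul, v.intValuation_singleton hp.ne_zero rfl,
    (HeightOneSpectrum.intValuation_eq_one_iff (x := m)).2
      (fun h => hm (Ideal.mem_span_singleton.1 h)),
    mul_one] at h2
  have hb0 : v.intValuation b ≠ 0 := v.intValuation_ne_zero b hb
  generalize v.intValuation b = β at h2 hb0
  generalize Valued.v (z.2 v) = ζ at h2
  have hz0 : ζ ≠ 0 := by
    rintro rfl
    rw [mul_zero] at h2
    exact mul_ne_zero (pow_ne_zero 2 hb0) WithZero.exp_ne_zero h2.symm
  have h4 := congrArg WithZero.log h2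
  rw [WithZero.log_mul hz0 hz0, WithZero.log_mul (pow_ne_zero 2 hb0) WithZero.exp_ne_zero,
    WithZero.log_pow, WithZero.log_exp, two_nsmul] at h4
  omega

/-- A rational number which is a square in the adèles is a square. -/
theorem exists_eq_sq_of_sq_eq {z : RatAdeles} {d : ℚ} (h : z ^ 2 = algebraMap ℚ RatAdeles d) :
    ∃ δ : ℚ, d = δ ^ 2 := by
  rcases eq_or_ne d 0 with rfl | hd
  · exact ⟨0, by norm_num⟩
  -- Replace `d` by the integer `N = d * d.den ^ 2` and split off the squarefree part `a` of `|N|`.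
  have hden : (d.den : ℚ) ≠ 0 := by exact_mod_cast d.den_ne_zero
  obtain ⟨N, hN⟩ : ∃ N : ℤ, N = d.num * d.den := ⟨_, rfl⟩
  have hNd : (N : ℚ) = (d.den : ℚ) ^ 2 * d := by
    rw [hN]
    push_cast
    rw [pow_two, mul_assoc, Rat.den_mul_eq_num, mul_comm]
  have hN0 : N ≠ 0 := by
    rw [hN]
    exact mul_ne_zero (Rat.num_ne_zero.2 hd) (by exact_mod_cast d.den_ne_zero)
  have hz : (algebraMap ℚ RatAdeles d.den * z) ^ 2 = algebraMap ℚ RatAdeles N := by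
    rw [mul_pow, h, hNd, map_mul, map_pow]
  obtain ⟨a, b, ha, hb, hab, hsq⟩ := Nat.sq_mul_squarefree_of_pos (Int.natAbs_pos.2 hN0)
  have hb0 : (b : ℤ) ≠ 0 := by exact_mod_cast hb.ne'
  rcases eq_or_ne a 1 with rfl | ha1
  · rcases Int.natAbs_eq N with hN' | hN'
    · refine ⟨b / d.den, ?_⟩
      rw [← hab] at hN'
      rw [div_pow, eq_div_iff (pow_ne_zero 2 hden), mul_comm, ← hNd, hN']
      push_cast
      ring
    · rw [← hab] at hN'
      exact absurd (by rw [hN']; push_cast; ring) (ne_neg_sq_of_sq_eq hb0 hz)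
  · obtain ⟨p, hp, m, rfl⟩ := Nat.exists_prime_and_dvd ha1
    have hpm : ¬ (p : ℤ) ∣ m := by
      intro hpm
      have hpm' : p ∣ m := by exact_mod_cast hpm
      exact hp.not_isUnit (hsq p (mul_dvd_mul_left p hpm'))
    rcases Int.natAbs_eq N with hN' | hN' <;> rw [← hab] at hN'
    · refine absurd hz ?_
      rw [show N = (b : ℤ) ^ 2 * (p * m) by rw [hN']; push_cast; ring]
      exact sq_ne_of_prime (Nat.prime_iff_prime_int.1 hp) hpm hb0
    · refine absurd hz ?_
      rw [show N = (b : ℤ) ^ 2 * (p * (-m)) by rw [hN']; push_cast; ring]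
      exact sq_ne_of_prime (Nat.prime_iff_prime_int.1 hp) (by rwa [dvd_neg]) hb0

/-- An adèle quadratic over `ℚ` lies in some `ℚ[e_Z]`: after completing the square it becomes a
square root of a rational square. -/
theorem exists_mem_idempotentSubalgebra {x : RatAdeles}
    (h : ¬ LinearIndependent ℚ ![1, x, x ^ 2]) : ∃ Z, x ∈ idempotentSubalgebra Z := by
  obtain ⟨g, hg, i, hi⟩ := Fintype.not_linearIndependent_iff.1 h
  simp only [Fin.sum_univ_three, Matrix.cons_val_zero, Matrix.cons_val_one, Matrix.cons_val,
    Algebra.smul_def, mul_one] at hg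
  set φ := algebraMap ℚ RatAdeles
  have hinj : Function.Injective φ := φ.injective
  have mem_of_eq : ∀ (Z) (c r : ℚ), c ≠ 0 → ∀ y ∈ idempotentSubalgebra Z, φ c * x = φ r + y →
      x ∈ idempotentSubalgebra Z := by
    intro Z c r hc y hy hxy
    have : x = φ c⁻¹ * (φ r + y) := by
      rw [← hxy, ← mul_assoc, ← map_mul, inv_mul_cancel₀ hc, map_one, one_mul]
    rw [this]
    exact mul_mem (Subalgebra.algebraMap_mem _ _) (add_mem (Subalgebra.algebraMap_mem _ _) hy)
  by_cases h2 : g 2 = 0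
  · rw [h2, map_zero, zero_mul, add_zero] at hg
    have h1 : g 1 ≠ 0 := by
      intro h1
      rw [h1, map_zero, zero_mul, add_zero] at hg
      have h0 : g 0 = 0 := hinj (hg.trans (map_zero φ).symm)
      fin_cases i
      exacts [hi h0, hi h1, hi h2]
    exact ⟨∅, mem_of_eq ∅ (g 1) (-g 0) h1 0 (zero_mem _) (by
      rw [map_neg]; linear_combination hg)⟩
  have h2' : 2 * g 2 ≠ 0 := mul_ne_zero two_ne_zero h2
  have hz : (φ (2 * g 2) * x + φ (g 1)) ^ 2 = φ (g 1 ^ 2 - 4 * g 0 * g 2) := by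
    simp only [map_sub, map_mul, map_pow, map_ofNat]
    linear_combination (4 * φ (g 2)) * hg
  obtain ⟨δ, hδ⟩ := exists_eq_sq_of_sq_eq hz
  rw [hδ] at hz
  rcases eq_or_ne δ 0 with rfl | hδ0
  · rw [zero_pow two_ne_zero, map_zero] at hz
    refine ⟨∅, mem_of_eq ∅ _ (-g 1) h2' 0 (zero_mem _) ?_⟩
    rw [map_neg]
    linear_combination eq_zero_of_sq_eq_zero hz
  · obtain ⟨Z, hZ⟩ := exists_eq_idempotentAdele_of_sq_eq_one
      (z := φ δ⁻¹ * (φ (2 * g 2) * x + φ (g 1))) (by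
        rw [mul_pow, hz, ← map_pow, ← map_mul, inv_pow, inv_mul_cancel₀ (pow_ne_zero 2 hδ0),
          map_one])
    refine ⟨Z, mem_of_eq Z _ (-g 1) h2' (φ δ * (2 * idempotentAdele Z - 1)) ?_ ?_⟩
    · refine mul_mem (Subalgebra.algebraMap_mem _ _) (sub_mem (mul_mem ?_ ?_) (one_mem _))
      · exact ofNat_mem _ 2
      · exact Algebra.self_mem_adjoin_singleton ℚ _
    · rw [← hZ, ← mul_assoc, ← map_mul, mul_inv_cancel₀ hδ0, map_one, map_neg]
      ring

end RatAdeles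

theorem theorem6p4 (ρ : HyperringHom ℤ[X] RatAdeleClasses) :
    (∃! a : RatAdeles, ρ = evalClass a) ∨
    (∃ (Z : Set RatPlace) (σ : HyperringHom ℤ[X] (ScalarQuotient ℚ (idempotentSubalgebra Z))),
      ρ = (ScalarQuotient.map (idempotentSubalgebra Z).val).comp σ) := by
  obtain ⟨x, hX⟩ := exists_cls (ρ X)
  by_cases hli : LinearIndependent ℚ ![1, x, x ^ 2]
  · left
    obtain ⟨a, ha, hu⟩ := HyperringHom.existsUnique_eval hX hli
    exact ⟨a, HyperringHom.ext ha, fun b hb => hu b fun P => DFunLike.congr_fun hb P⟩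
  · right
    obtain ⟨Z, hZ⟩ := RatAdeles.exists_mem_idempotentSubalgebra hli
    exact ⟨Z, HyperringHom.exists_eq_comp_map_val _
      (HyperringHom.exists_mem_apply_eq_cls hZ hX)⟩
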